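/- Let $R$ be a commutative ring and $C=(C,\Delta,\varepsilon)$ a (coassociative, counital) $R$-coalgebra. Write $\tau$ for the twist map, $C^\tau=(C,\tau\Delta,\varepsilon)$ for the opposite coalgebra, and $C^e=C\otimes_R C^\tau$ for the tensor product coalgebra. Let $\mathbb M_R$ be the category of $R$-modules and ${}^{C^e}\mathbb M$ the category of left $C^e$-comodules (equivalently, of $(C,C)$-bicomodules). For an $R$-module $M$, $C\otimes_R M$ is a left $C^e$-comodule by the coaction $c\otimes m\mapsto (c_1\otimes c_3)\otimes c_2\otimes m$, where $c_1\otimes c_2\otimes c_3=(C\otimes\Delta)\Delta(c)$; in particular (for $M=R$) $C$ is one. Let $K:\mathbb M_R\to{}^{C^e}\mathbb M$, $M\mapsto C\otimes_R M$, be the resulting functor. It has the right adjoint ${}^{C^e}\mathrm{Hom}(C,-)$, with unit $\underline\eta_M:M\to{}^{C^e}\mathrm{Hom}(C,C\otimes_R M)$, $m\mapsto(c\mapsto c\otimes m)$, and counit $\underline\varepsilon_X:C\otimes_R{}^{C^e}\mathrm{Hom}(C,X)\to X$, $c\otimes f\mapsto f(c)$. Let $C^*=\mathrm{Hom}_R(C,R)$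 be the dual $R$-algebra, with product $f*g=(g\otimes f)\Delta$ and unit $\varepsilon$. The following are equivalent: (a) $C$ is an Azumaya coalgebra, i.e. $K$ is an equivalence of categories. (b) $\underline\varepsilon_X$ is an isomorphism for every $X\in{}^{C^e}\mathbb M$, and $\underline\eta_M$ is an isomorphism for every $M\in\mathbb M_R$. (c) $C$ is a $C^e$-Galois comodule, i.e. with $S={}^{C^e}\mathrm{Hom}(C,C)$ the map $C\otimes_S\mathrm{Hom}_R(C,N)\to C^e\otimes_R N$, $c\otimes f\mapsto (c_1\otimes c_3)\otimes f(c_2)$, is an isomorphism for every $R$-module $N$; $C^*$ is a central $R$-algebra, i.e. the canonical map from $R$ to the center of $C^*$ is an isomorphism; and the functor $C\otimes_R-:\mathbb M_R\to\mathbb M_R$ is comonadic. (d) $C$ is finitely generated and projective as an $R$-module, and $C^*$ is an Azumaya $R$-algebra. -/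

import Mathlib

universe u

set_option linter.unusedSimpArgs false

noncomputable section

namespace AzumayaCoalg

open scoped TensorProduct
open Coalgebra CategoryTheory

/-- The underlying module of the opposite coalgebra `C^τ` of `C`, whose comultiplication is
`Δ^τ = τ ∘ Δ`. -/
def CoOp (C : Type u) : Type u := C

namespace CoOp
variable (R C : Type u) [CommRing R] [AddCommGroup C] [Module R C]
instance : AddCommGroup (CoOp C) := inferInstanceAs (AddCommGroup C)
instance : Module R (CoOp C) := inferInstanceAs (Module R C)
/-- The identity map `C → C^τ`. -/
def equiv : C ≃ₗ[R] CoOp C := LinearEquiv.refl R C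

variable [Coalgebra R C]
instance : CoalgebraStruct R (CoOp C) where
  comul := TensorProduct.map (equiv R C).toLinearMap (equiv R C).toLinearMap ∘ₗ
    (TensorProduct.comm R C C).toLinearMap ∘ₗ comul ∘ₗ (equiv R C).symm.toLinearMap
  counit := counit ∘ₗ (equiv R C).symm.toLinearMap

theorem comul_apply (c : C) : (comul (equiv R C c) : CoOp C ⊗[R] CoOp C) =
    TensorProduct.map (equiv R C).toLinearMap (equiv R C).toLinearMap
      (TensorProduct.comm R C C (comul c)) := rfl

theorem counit_apply (c : C) : (counit (equiv R C c) : R) = counit c := rfl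

instance : Coalgebra R (CoOp C) where
  coassoc := by
    apply LinearMap.ext
    intro x
    obtain ⟨c, rfl⟩ := (equiv R C).surjective x
    let F : (C ⊗[R] (C ⊗[R] C)) →ₗ[R] CoOp C ⊗[R] (CoOp C ⊗[R] CoOp C) :=
      (TensorProduct.map (equiv R C).toLinearMap
        (TensorProduct.map (equiv R C).toLinearMap (equiv R C).toLinearMap)) ∘ₗ
      (TensorProduct.assoc R C C C).toLinearMap ∘ₗ (TensorProduct.comm R C (C ⊗[R] C)).toLinearMap ∘ₗ
      (TensorProduct.comm R C C).toLinearMap.lTensor C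
    have h := congrArg F (coassoc_apply (R := R) c)
    simp only [LinearMap.comp_apply, comul_apply]
    refine Eq.trans ?_ (h.symm.trans ?_)
    · hopf_tensor_induction comul (R := R) c with x y
      simp only [TensorProduct.comm_tmul, TensorProduct.map_tmul, LinearEquiv.coe_coe,
        LinearMap.rTensor_tmul, LinearMap.lTensor_tmul, comul_apply]
      hopf_tensor_induction comul (R := R) y with z w
      rfl
    · hopf_tensor_induction comul (R := R) c with x y
      simp only [TensorProduct.comm_tmul, TensorProduct.map_tmul, LinearEquiv.coe_coe,
        LinearMap.rTensor_tmul, LinearMap.lTensor_tmul, comul_apply]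
      hopf_tensor_induction comul (R := R) x with z w
      rfl
  rTensor_counit_comp_comul := by
    apply LinearMap.ext
    intro x
    obtain ⟨c, rfl⟩ := (equiv R C).surjective x
    have h := congrArg ((equiv R C).toLinearMap.lTensor R ∘ₗ (TensorProduct.comm R C R).toLinearMap)
      (lTensor_counit_comul (R := R) c)
    refine Eq.trans ?_ h
    simp only [LinearMap.comp_apply, comul_apply]
    hopf_tensor_induction comul (R := R) c with x y
    rfl
  lTensor_counit_comp_comul := by
    apply LinearMap.ext
    intro x
    obtain ⟨c, rfl⟩ := (equiv R C).surjective x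
    have h := congrArg ((equiv R C).toLinearMap.rTensor R ∘ₗ (TensorProduct.comm R R C).toLinearMap)
      (rTensor_counit_comul (R := R) c)
    refine Eq.trans ?_ h
    simp only [LinearMap.comp_apply, comul_apply]
    hopf_tensor_induction comul (R := R) c with x y
    rfl
end CoOp

section
variable (R C : Type u) [CommRing R] [AddCommGroup C] [Module R C] [Coalgebra R C]
/-- The coalgebra `Cᵉ = C ⊗_R C^τ`, with Mathlib's tensor product coalgebra structure. -/
abbrev Env : Type u := C ⊗[R] CoOp C

/-- The left `Cᵉ`-coaction `(C ⊗ Δ^τ) ∘ Δ` of `C`, i.e. `c ↦ (c₁ ⊗ c₃) ⊗ c₂`. -/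
def bicoact : C →ₗ[R] Env R C ⊗[R] C :=
  (TensorProduct.assoc R C (CoOp C) C).symm.toLinearMap ∘ₗ
    ((CoOp.equiv R C).toLinearMap.rTensor C ∘ₗ
      (TensorProduct.comm R C C).toLinearMap ∘ₗ comul).lTensor C ∘ₗ comul

theorem bicoact_counit (c : C) :
    TensorProduct.lid R C ((counit : Env R C →ₗ[R] R).rTensor C (bicoact R C c)) = c := by
  have h2 : TensorProduct.lid R C ((counit : C →ₗ[R] R).rTensor C
      ((TensorProduct.rid R C).toLinearMap.lTensor C
        (((counit : C →ₗ[R] R).lTensor C).lTensor C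
          ((comul : C →ₗ[R] _).lTensor C (comul c))))) = c := by
    have : ∀ z : C ⊗[R] C, (TensorProduct.rid R C).toLinearMap.lTensor C
        (((counit : C →ₗ[R] R).lTensor C).lTensor C ((comul : C →ₗ[R] _).lTensor C z)) = z := by
      intro z
      hopf_tensor_induction z with x y
      simp
    rw [this]
    simp
  refine Eq.trans ?_ h2
  simp only [bicoact, LinearMap.comp_apply]
  hopf_tensor_induction comul (R := R) c with x y
  simp only [LinearMap.lTensor_tmul, LinearMap.comp_apply]
  hopf_tensor_induction comul (R := R) y with z w
  simp [CoOp.counit_apply, mul_smul]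

variable {R C} in
theorem comul_four (y : C) :
    (TensorProduct.assoc R C C C).toLinearMap.lTensor C
      (TensorProduct.assoc R C (C ⊗[R] C) C
        (((comul : C →ₗ[R] _).lTensor C ∘ₗ comul).rTensor C (comul y))) =
      ((comul : C →ₗ[R] _).lTensor C ∘ₗ comul).lTensor C (comul y) := by
  let F : (C ⊗[R] C) ⊗[R] C →ₗ[R] C ⊗[R] (C ⊗[R] (C ⊗[R] C)) :=
    (TensorProduct.assoc R C C C).toLinearMap.lTensor C ∘ₗ
      (TensorProduct.assoc R C (C ⊗[R] C) C).toLinearMap ∘ₗ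
      ((comul : C →ₗ[R] _).lTensor C).rTensor C
  have h := congrArg F (coassoc_symm_apply (R := R) y)
  refine Eq.trans ?_ (h.symm.trans ?_)
  · hopf_tensor_induction comul (R := R) y with a b
    rfl
  · hopf_tensor_induction comul (R := R) y with a b
    simp only [LinearMap.lTensor_tmul, LinearMap.comp_apply, ← coassoc_apply]
    hopf_tensor_induction comul (R := R) b with c d
    rfl

theorem bicoact_coassoc (c : C) :
    TensorProduct.assoc R _ _ _ ((comul : Env R C →ₗ[R] _).rTensor C (bicoact R C c)) =
      (bicoact R C).lTensor (Env R C) (bicoact R C c) := by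
  let e := (CoOp.equiv R C).toLinearMap
  let Q : C ⊗[R] (C ⊗[R] C) →ₗ[R] C ⊗[R] (C ⊗[R] C) :=
    (TensorProduct.assoc R C C C).toLinearMap ∘ₗ
      (TensorProduct.comm R C C).toLinearMap.rTensor C ∘ₗ
      (TensorProduct.comm R C (C ⊗[R] C)).toLinearMap
  let P : C ⊗[R] (C ⊗[R] (C ⊗[R] (C ⊗[R] C))) →ₗ[R] Env R C ⊗[R] (Env R C ⊗[R] C) :=
    TensorProduct.map (e.lTensor C)
      ((e.lTensor C).rTensor C ∘ₗ (TensorProduct.assoc R C C C).symm.toLinearMap) ∘ₗ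
    (TensorProduct.assoc R C C (C ⊗[R] (C ⊗[R] C))).symm.toLinearMap ∘ₗ
    ((TensorProduct.leftComm R C C (C ⊗[R] C)).toLinearMap ∘ₗ Q.lTensor C).lTensor C
  let D : C →ₗ[R] C ⊗[R] (C ⊗[R] C) := (comul : C →ₗ[R] _).lTensor C ∘ₗ comul
  have h1 := congrArg (P ∘ₗ (TensorProduct.assoc R C C (C ⊗[R] (C ⊗[R] C))).toLinearMap ∘ₗ
    D.lTensor (C ⊗[R] C)) (coassoc_symm_apply (R := R) c)
  have h2 : ((TensorProduct.assoc R C C C).toLinearMap.lTensor C ∘ₗ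
      (TensorProduct.assoc R C (C ⊗[R] C) C).toLinearMap ∘ₗ D.rTensor C ∘ₗ comul).lTensor C
      (comul c) = (D.lTensor C ∘ₗ comul).lTensor C (comul c) := by
    congr 2
    exact LinearMap.ext fun y => comul_four y
  have h3 := congrArg P h2
  refine Eq.trans ?_ (h1.symm.trans (Eq.trans ?_ (h3.symm.trans ?_)))
  · simp only [bicoact, LinearMap.comp_apply]
    hopf_tensor_induction comul (R := R) c with a b
    simp only [LinearMap.lTensor_tmul, LinearMap.rTensor_tmul, LinearMap.comp_apply, D]
    hopf_tensor_induction comul (R := R) b with p q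
    simp only [LinearMap.lTensor_tmul, LinearMap.rTensor_tmul, LinearMap.comp_apply,
      LinearEquiv.coe_coe, TensorProduct.comm_tmul, TensorProduct.assoc_symm_tmul,
      TensorProduct.comul_tmul, CoOp.comul_apply]
    hopf_tensor_induction comul (R := R) a with r s
    hopf_tensor_induction comul (R := R) q with t w
    rfl
  · simp only [LinearMap.comp_apply]
    hopf_tensor_induction comul (R := R) c with a b
    simp only [LinearMap.lTensor_tmul, LinearMap.comp_apply]
    hopf_tensor_induction comul (R := R) b with p q
    rfl
  · simp only [bicoact, LinearMap.comp_apply]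
    hopf_tensor_induction comul (R := R) c with a b
    simp only [LinearMap.lTensor_tmul, LinearMap.rTensor_tmul, LinearMap.comp_apply, D]
    hopf_tensor_induction comul (R := R) b with p q
    simp only [LinearMap.lTensor_tmul, LinearMap.rTensor_tmul, LinearMap.comp_apply,
      LinearEquiv.coe_coe, TensorProduct.comm_tmul, TensorProduct.assoc_symm_tmul]
    hopf_tensor_induction comul (R := R) p with r s
    simp only [LinearMap.lTensor_tmul, LinearMap.rTensor_tmul, LinearMap.comp_apply,
      LinearEquiv.coe_coe, TensorProduct.comm_tmul, TensorProduct.assoc_symm_tmul,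
      TensorProduct.assoc_tmul]
    hopf_tensor_induction comul (R := R) s with t w
    rfl
end

section
variable (R D : Type u) [CommRing R] [AddCommGroup D] [Module R D]

/-- The functor `D ⊗_R -` on the category of `R`-modules. -/
def tensorFunctor : ModuleCat.{u} R ⥤ ModuleCat.{u} R where
  obj M := ModuleCat.of R (D ⊗[R] M)
  map f := ModuleCat.ofHom (f.hom.lTensor D)
  map_id M := by
    ext : 1
    exact LinearMap.lTensor_id D M
  map_comp f g := by
    ext : 1
    exact LinearMap.lTensor_comp D g.hom f.hom

variable [Coalgebra R D]

/-- The comonad structure on `D ⊗_R -`. -/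
def tensorComonad : Comonad (ModuleCat.{u} R) where
  toFunctor := tensorFunctor R D
  ε :=
    { app := fun M => ModuleCat.ofHom
        ((TensorProduct.lid R M).toLinearMap ∘ₗ (counit : D →ₗ[R] R).rTensor M)
      naturality := fun M N f => by
        ext : 1
        apply TensorProduct.ext'
        intro d m
        simp [tensorFunctor] }
  δ :=
    { app := fun M => ModuleCat.ofHom
        ((TensorProduct.assoc R D D M).toLinearMap ∘ₗ (comul : D →ₗ[R] D ⊗[R] D).rTensor M)
      naturality := fun M N f => by
        ext : 1
        apply TensorProduct.ext'
        intro d m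
        change TensorProduct.assoc R D D N (comul d ⊗ₜ[R] f.hom m) =
          (f.hom.lTensor D).lTensor D (TensorProduct.assoc R D D M (comul d ⊗ₜ[R] m))
        hopf_tensor_induction comul (R := R) d with x y
        rfl }
  coassoc M := by
    ext : 1
    apply TensorProduct.ext'
    intro d m
    let F : D ⊗[R] (D ⊗[R] D) →ₗ[R] D ⊗[R] (D ⊗[R] (D ⊗[R] M)) :=
      (TensorProduct.assoc R D D M).toLinearMap.lTensor D ∘ₗ
        (TensorProduct.assoc R D (D ⊗[R] D) M).toLinearMap ∘ₗ
        (TensorProduct.mk R (D ⊗[R] (D ⊗[R] D)) M).flip m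
    have h := congrArg F (coassoc_apply (R := R) d)
    refine Eq.trans ?_ (h.symm.trans ?_)
    · change ((TensorProduct.assoc R D D M).toLinearMap ∘ₗ
        (comul : D →ₗ[R] D ⊗[R] D).rTensor M).lTensor D
          (TensorProduct.assoc R D D M (comul d ⊗ₜ[R] m)) = _
      hopf_tensor_induction comul (R := R) d with x y
      rfl
    · change _ = TensorProduct.assoc R D D (D ⊗[R] M)
        ((comul : D →ₗ[R] D ⊗[R] D).rTensor (D ⊗[R] M)
          (TensorProduct.assoc R D D M (comul d ⊗ₜ[R] m)))
      hopf_tensor_induction comul (R := R) d with x y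
      simp only [LinearMap.rTensor_tmul, TensorProduct.assoc_tmul]
      hopf_tensor_induction comul (R := R) x with z w
      rfl
  left_counit M := by
    ext : 1
    apply TensorProduct.ext'
    intro d m
    have h := congrArg (fun z => TensorProduct.lid R D z ⊗ₜ[R] m)
      (rTensor_counit_comul (R := R) d)
    simp only [TensorProduct.lid_tmul, one_smul] at h
    refine Eq.trans ?_ h
    change TensorProduct.lid R (D ⊗[R] M) ((counit : D →ₗ[R] R).rTensor (D ⊗[R] M)
      (TensorProduct.assoc R D D M (comul d ⊗ₜ[R] m))) = _
    hopf_tensor_induction comul (R := R) d with x y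
    simp [TensorProduct.smul_tmul']
  right_counit M := by
    ext : 1
    apply TensorProduct.ext'
    intro d m
    have h := congrArg (fun z => TensorProduct.rid R D z ⊗ₜ[R] m)
      (lTensor_counit_comul (R := R) d)
    simp only [TensorProduct.rid_tmul, one_smul] at h
    refine Eq.trans ?_ h
    change ((TensorProduct.lid R M).toLinearMap ∘ₗ (counit : D →ₗ[R] R).rTensor M).lTensor D
      (TensorProduct.assoc R D D M (comul d ⊗ₜ[R] m)) = _
    hopf_tensor_induction comul (R := R) d with x y
    simp [TensorProduct.smul_tmul]

/-- The category `^D M` of left `D`-comodules, i.e. the Eilenberg-Moore category of the comonad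
`D ⊗_R -`. -/
abbrev LeftComodule : Type (u + 1) := (tensorComonad R D).Coalgebra
end

section
variable (R C : Type u) [CommRing R] [AddCommGroup C] [Module R C] [Coalgebra R C]

/-- The left `Cᵉ`-comodule `C ⊗_R M`, with the coaction induced by that of `C`. -/
def comparisonObj (M : ModuleCat.{u} R) : LeftComodule R (Env R C) where
  A := ModuleCat.of R (C ⊗[R] M)
  a := ModuleCat.ofHom ((TensorProduct.assoc R (Env R C) C M).toLinearMap ∘ₗ
    (bicoact R C).rTensor M)
  counit := by
    ext : 1
    apply TensorProduct.ext'
    intro c m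
    refine Eq.trans ?_ (congrArg (fun z => z ⊗ₜ[R] m) (bicoact_counit R C c))
    change TensorProduct.lid R (C ⊗[R] M) ((counit : Env R C →ₗ[R] R).rTensor (C ⊗[R] M)
      (TensorProduct.assoc R (Env R C) C M (bicoact R C c ⊗ₜ[R] m))) = _
    hopf_tensor_induction bicoact R C c with x y
    simp [TensorProduct.smul_tmul']
  coassoc := by
    ext : 1
    apply TensorProduct.ext'
    intro c m
    let F : Env R C ⊗[R] (Env R C ⊗[R] C) →ₗ[R] Env R C ⊗[R] (Env R C ⊗[R] (C ⊗[R] M)) :=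
      (TensorProduct.assoc R (Env R C) C M).toLinearMap.lTensor (Env R C) ∘ₗ
        (TensorProduct.assoc R (Env R C) (Env R C ⊗[R] C) M).toLinearMap ∘ₗ
        (TensorProduct.mk R (Env R C ⊗[R] (Env R C ⊗[R] C)) M).flip m
    refine Eq.trans ?_ ((congrArg F (bicoact_coassoc R C c)).trans ?_)
    · change TensorProduct.assoc R (Env R C) (Env R C) (C ⊗[R] M)
        ((comul : Env R C →ₗ[R] _).rTensor (C ⊗[R] M)
          (TensorProduct.assoc R (Env R C) C M (bicoact R C c ⊗ₜ[R] m))) = _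
      hopf_tensor_induction bicoact R C c with x y
      simp only [LinearMap.rTensor_tmul, TensorProduct.assoc_tmul]
      hopf_tensor_induction comul (R := R) x with z w
      rfl
    · change _ = ((TensorProduct.assoc R (Env R C) C M).toLinearMap ∘ₗ
        (bicoact R C).rTensor M).lTensor (Env R C)
          (TensorProduct.assoc R (Env R C) C M (bicoact R C c ⊗ₜ[R] m))
      hopf_tensor_induction bicoact R C c with x y
      rfl

/-- The comparison functor `K : M_R ⥤ ^{Cᵉ}M`, `M ↦ C ⊗_R M`. -/
def comparison : ModuleCat.{u} R ⥤ LeftComodule R (Env R C) where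
  obj M := comparisonObj R C M
  map {M N} f :=
    { f := ModuleCat.ofHom (f.hom.lTensor C)
      h := by
        ext : 1
        apply TensorProduct.ext'
        intro c m
        change (f.hom.lTensor C).lTensor (Env R C)
          (TensorProduct.assoc R (Env R C) C M (bicoact R C c ⊗ₜ[R] m)) =
            TensorProduct.assoc R (Env R C) C N (bicoact R C c ⊗ₜ[R] f.hom m)
        hopf_tensor_induction bicoact R C c with x y
        rfl }
  map_id M := by
    apply Comonad.Coalgebra.Hom.ext'
    ext : 1
    exact LinearMap.lTensor_id C M
  map_comp f g := by
    apply Comonad.Coalgebra.Hom.ext'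
    ext : 1
    exact LinearMap.lTensor_comp C g.hom f.hom

/-- `^{Cᵉ}Hom(C, X)`: the linear maps `f : C → X` with `ρ_X ∘ f = (Cᵉ ⊗ f) ∘ ρ_C`. -/
def comoduleHom (X : LeftComodule R (Env R C)) : Submodule R (C →ₗ[R] X.A) where
  carrier := {f | ∀ c, X.a.hom (f c) = f.lTensor (Env R C) (bicoact R C c)}
  zero_mem' c := by
    rw [LinearMap.lTensor_zero]
    simp only [LinearMap.zero_apply, map_zero]
    rfl
  add_mem' {f g} hf hg c := by
    rw [LinearMap.lTensor_add]
    simp only [LinearMap.add_apply, map_add, hf c, hg c]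
    rfl
  smul_mem' r f hf c := by
    rw [LinearMap.lTensor_smul]
    simp only [LinearMap.smul_apply, map_smul, hf c]
    rfl

/-- The functor `^{Cᵉ}Hom(C, -) : ^{Cᵉ}M ⥤ M_R`. -/
def comoduleHomFunctor : LeftComodule R (Env R C) ⥤ ModuleCat.{u} R where
  obj X := ModuleCat.of R (comoduleHom R C X)
  map {X Y} g := ModuleCat.ofHom
    ((g.f.hom.compRight R (M := C)).restrict (p := comoduleHom R C X)
      (q := comoduleHom R C Y) fun f hf c => by
        have h := LinearMap.congr_fun (ModuleCat.hom_ext_iff.mp g.h) (f c)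
        refine Eq.trans h.symm ?_
        change g.f.hom.lTensor (Env R C) (X.a.hom (f c)) =
          (g.f.hom ∘ₗ f).lTensor (Env R C) (bicoact R C c)
        rw [hf c, LinearMap.lTensor_comp]
        rfl)
  map_id X := rfl
  map_comp f g := rfl

/-- `M → ^{Cᵉ}Hom(C, C ⊗_R M)`, `m ↦ (c ↦ c ⊗ m)`. -/
def comparisonUnit (M : ModuleCat.{u} R) :
    M →ₗ[R] comoduleHom R C ((comparison R C).obj M) :=
  (TensorProduct.mk R C M).flip.codRestrict _ fun m c => by
    change TensorProduct.assoc R (Env R C) C M (bicoact R C c ⊗ₜ[R] m) =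
      ((TensorProduct.mk R C M).flip m).lTensor (Env R C) (bicoact R C c)
    hopf_tensor_induction bicoact R C c with x y
    rfl

/-- `C ⊗_R ^{Cᵉ}Hom(C, X) → X`, `c ⊗ f ↦ f c`. -/
def comparisonCounit (X : LeftComodule R (Env R C)) :
    C ⊗[R] comoduleHom R C X →ₗ[R] X.A :=
  TensorProduct.lift (LinearMap.flip (comoduleHom R C X).subtype)

theorem comparisonCounit_aux (X : LeftComodule R (Env R C)) (f : comoduleHom R C X)
    (z : Env R C ⊗[R] C) :
    (comparisonCounit R C X).lTensor (Env R C)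
        (TensorProduct.assoc R (Env R C) C (comoduleHom R C X) (z ⊗ₜ[R] f)) =
      (f : C →ₗ[R] X.A).lTensor (Env R C) z := by
  hopf_tensor_induction z with x y
  rfl

/-- The adjunction `K ⊣ ^{Cᵉ}Hom(C, -)` with the above unit and counit. -/
def comparisonAdj : comparison R C ⊣ comoduleHomFunctor R C :=
  Adjunction.mkOfUnitCounit
    { unit :=
        { app := fun M => ModuleCat.ofHom (comparisonUnit R C M)
          naturality := fun _ _ _ => rfl }
      counit :=
        { app := fun X =>
            { f := ModuleCat.ofHom (comparisonCounit R C X)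
              h := by
                ext : 1
                apply TensorProduct.ext'
                intro c f
                refine Eq.trans ?_ (f.2 c).symm
                exact comparisonCounit_aux R C X f (bicoact R C c) }
          naturality := fun X Y g => by
            apply Comonad.Coalgebra.Hom.ext'
            ext : 1
            apply TensorProduct.ext'
            intro c f
            rfl }
      left_triangle := by
        apply NatTrans.ext
        funext M
        apply Comonad.Coalgebra.Hom.ext'
        ext : 1
        apply TensorProduct.ext'
        intro c m
        rfl
      right_triangle := by
        ext X
        rfl }

/-- `C` as a left `Cᵉ`-comodule. -/
def regularComodule : LeftComodule R (Env R C) where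
  A := ModuleCat.of R C
  a := ModuleCat.ofHom (bicoact R C)
  counit := by
    ext : 1
    exact LinearMap.ext fun c => bicoact_counit R C c
  coassoc := by
    ext : 1
    exact LinearMap.ext fun c => bicoact_coassoc R C c

/-- `Hom^{Cᵉ}(C, C)`: the linear endomorphisms of `C` that are `Cᵉ`-comodule maps. -/
def comoduleEnd : Submodule R (C →ₗ[R] C) := comoduleHom R C (regularComodule R C)

/-- The relations `s(c) ⊗ f - c ⊗ (f ∘ s)`, `s ∈ S := Hom^{Cᵉ}(C, C)`; the quotient of
`C ⊗_R Hom_R(C, N)` by them is `C ⊗_S Hom_R(C, N)`. -/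
def balanced (N : Type u) [AddCommGroup N] [Module R N] : Submodule R (C ⊗[R] (C →ₗ[R] N)) :=
  Submodule.span R {z | ∃ s ∈ comoduleEnd R C, ∃ (c : C) (f : C →ₗ[R] N),
    z = s c ⊗ₜ[R] f - c ⊗ₜ[R] (f ∘ₗ s)}

/-- The map `C ⊗_R Hom_R(C, N) → Cᵉ ⊗_R N`: the coaction of `C` followed by evaluation. -/
def preGaloisMap (N : Type u) [AddCommGroup N] [Module R N] :
    C ⊗[R] (C →ₗ[R] N) →ₗ[R] Env R C ⊗[R] N :=
  (TensorProduct.lift LinearMap.applyₗ).lTensor (Env R C) ∘ₗ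
    (TensorProduct.assoc R (Env R C) C (C →ₗ[R] N)).toLinearMap ∘ₗ
      (bicoact R C).rTensor (C →ₗ[R] N)

theorem preGaloisMap_tmul (N : Type u) [AddCommGroup N] [Module R N] (c : C) (f : C →ₗ[R] N) :
    preGaloisMap R C N (c ⊗ₜ[R] f) = f.lTensor (Env R C) (bicoact R C c) := by
  change (TensorProduct.lift LinearMap.applyₗ).lTensor (Env R C)
    (TensorProduct.assoc R (Env R C) C (C →ₗ[R] N) (bicoact R C c ⊗ₜ[R] f)) = _
  hopf_tensor_induction bicoact R C c with x y
  rfl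

/-- The induced map `C ⊗_S Hom_R(C, N) → Cᵉ ⊗_R N`, where `S = Hom^{Cᵉ}(C, C)`. -/
def galoisMap (N : Type u) [AddCommGroup N] [Module R N] :
    (C ⊗[R] (C →ₗ[R] N)) ⧸ balanced R C N →ₗ[R] Env R C ⊗[R] N :=
  (balanced R C N).liftQ (preGaloisMap R C N) <| by
    refine Submodule.span_le.mpr ?_
    rintro _ ⟨s, hs, c, f, rfl⟩
    have h : bicoact R C (s c) = LinearMap.lTensor (Env R C) s (bicoact R C c) := hs c
    change preGaloisMap R C N _ = 0
    rw [map_sub, preGaloisMap_tmul, preGaloisMap_tmul, h, LinearMap.lTensor_comp]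
    exact sub_self _

/-- `C` is a `Cᵉ`-Galois comodule: `C ⊗_S Hom_R(C, -) → Cᵉ ⊗_R -` is an isomorphism,
where `S = Hom^{Cᵉ}(C, C)`. If `S = R` this is `C ⊗_R Hom_R(C, -) ≅ Cᵉ ⊗_R -`. -/
def IsGalois : Prop :=
  ∀ (N : Type u) [AddCommGroup N] [Module R N], Function.Bijective (galoisMap R C N)

/-- The dual algebra `C* = Hom_R(C, R)` with product `f * g = (g ⊗ f) ∘ Δ` and unit `ε`, i.e. the
opposite of Mathlib's convolution algebra. -/
abbrev DualAlg : Type u := (WithConv (C →ₗ[R] R))ᵐᵒᵖ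

/-- `C*` is a central `R`-algebra: the canonical map from `R` to the center of `C*` is
surjective and injective. -/
def IsCentralDual : Prop := Algebra.IsCentral R (DualAlg R C) ∧ FaithfulSMul R (DualAlg R C)

/-- `C` is an Azumaya coalgebra: `M ↦ C ⊗_R M` is an equivalence `M_R ≃ ^{Cᵉ}M`. -/
def IsAzumayaCoalgebra : Prop := (comparison R C).IsEquivalence
end
end AzumayaCoalg
end

/-! Everything is read off the maps γ_N = `preGaloisMap R C N`: C ⊗_R Hom(C, N) → Cᵉ ⊗ N, the Galois
maps before passing to S. When C is finitely generated projective, γ_R is up to duality the map C* ⊗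
(C*)ᵒᵖ → End(C*), because (a * h * b)(c) = b(c₁) h(c₂) a(c₃); so one is bijective iff the other is
(`mulLeftRight_bijective_iff`), and γ_N follows from γ_R by tensoring with N.

From (b) or (c) to (d): in (b), γ_N is the counit at the cofree comodule Cᵉ ⊗ N; in (c), centrality
of C* forces S to consist of scalars, so that ⊗_S is ⊗_R. In both cases C ⊗ - reflects isomorphisms.
Comparing γ_C with γ_R then shows that C* ⊗ C → End(C) is an isomorphism after tensoring with C,
hence before, and a preimage of the identity is a dual basis of C.

From (d) back: C is finitely generated, projective and faithful, hence faithfully flat. Through the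
γ's, the equalizer defining ^{Cᵉ}Hom(C, X), tensored with C, becomes the fork X → Cᵉ ⊗ X ⇉ Cᵉ ⊗ Cᵉ ⊗
X, so the counit is bijective (`evaluation_bijective`); the unit follows by a triangle identity and
faithful flatness. Comonadicity is Beck's theorem, and centrality holds for every Azumaya algebra.
The equivalence of (a) and (b) is formal. -/

noncomputable section

open scoped TensorProduct

/-! ### Projective generators, equalizers and duals over a commutative ring. -/

/-- A finitely generated projective faithful module over a commutative ring is faithfully flat. -/
theorem Module.FaithfullyFlat.of_finite_projective_faithfulSMul (R M : Type*) [CommRing R]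
    [AddCommGroup M] [Module R M] [Module.Finite R M] [Module.Projective R M] [FaithfulSMul R M] :
    Module.FaithfullyFlat R M where
  submodule_ne_top m hm h := by
    -- Nakayama: if mM = M, some r ≡ 1 mod m kills M; faithfulness gives r = 0, so 1 ∈ m.
    obtain ⟨r, hr, hz⟩ := Submodule.exists_sub_one_mem_and_smul_eq_zero_of_fg_of_le_smul m
      (⊤ : Submodule R M) Module.Finite.fg_top h.ge
    have h0 : r = 0 := FaithfulSMul.eq_of_smul_eq_smul (α := M) fun x => by
      rw [hz x trivial, zero_smul]
    refine hm.ne_top ((Ideal.eq_top_iff_one m).mpr ?_)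
    simpa [h0] using hr

/-- The trace ideal of a faithfully flat projective module is the whole ring. -/
theorem Module.FaithfullyFlat.span_dual_apply_eq_top (R M : Type*) [CommRing R]
    [AddCommGroup M] [Module R M] [Module.Projective R M] [Module.FaithfullyFlat R M] :
    Ideal.span {r : R | ∃ (f : Module.Dual R M) (x : M), f x = r} = ⊤ := by
  by_contra hne
  obtain ⟨m, hm, hle⟩ := Ideal.exists_le_maximal _ hne
  refine Module.FaithfullyFlat.submodule_ne_top (M := M) hm (top_unique fun x _ => ?_)
  -- The coordinates of a section s of R^(M) → M are functionals, so their values lie in m, and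
  -- expanding x in them puts x in mM.
  obtain ⟨s, hs⟩ := Module.projective_def'.mp ‹Module.Projective R M›
  have hx : Finsupp.linearCombination R id (s x) = x := LinearMap.congr_fun hs x
  rw [← hx, Finsupp.linearCombination_apply]
  exact Submodule.sum_mem _ fun y _ => Submodule.smul_mem_smul
    (hle (Ideal.subset_span ⟨Finsupp.lapply y ∘ₗ s, x, rfl⟩)) trivial

/-- An endomorphism of a projective generator which commutes with all endomorphisms is
multiplication by a scalar. -/
theorem Module.FaithfullyFlat.exists_eq_smul_of_commute {R M : Type*} [CommRing R]
    [AddCommGroup M] [Module R M] [Module.Projective R M] [Module.FaithfullyFlat R M]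
    (T : Module.End R M) (hT : ∀ (S : Module.End R M) (x : M), S (T x) = T (S x)) :
    ∃ r : R, ∀ x, T x = r • x := by
  have key : ∀ a ∈ Ideal.span {r : R | ∃ (f : Module.Dual R M) (x : M), f x = r},
      ∃ r : R, ∀ x, a • T x = r • x := by
    intro a ha
    induction ha using Submodule.span_induction with
    | mem a ha =>
      obtain ⟨f, y, rfl⟩ := ha
      -- T commutes with the rank-one map f(-)x; evaluated at y this reads f(T y) x = f(y) T x.
      refine ⟨f (T y), fun x => ?_⟩
      simpa using (hT (f.smulRight x) y).symm
    | zero => exact ⟨0, by simp⟩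
    | add a b _ _ ha hb =>
      obtain ⟨r, hr⟩ := ha
      obtain ⟨s, hs⟩ := hb
      exact ⟨r + s, fun x => by rw [add_smul, add_smul, hr, hs]⟩
    | smul c a _ ha =>
      obtain ⟨r, hr⟩ := ha
      exact ⟨c * r, fun x => by rw [smul_eq_mul, mul_smul, mul_smul, hr]⟩
  rw [Module.FaithfullyFlat.span_dual_apply_eq_top R M] at key
  obtain ⟨r, hr⟩ := key 1 trivial
  exact ⟨r, fun x => by rw [← hr, one_smul]⟩

/-- Azumaya algebras are central. -/
theorem IsAzumaya.isCentral (R A : Type*) [CommRing R] [Ring A] [Algebra R A] [IsAzumaya R A] :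
    Algebra.IsCentral R A where
  out z hz := by
    have := Module.FaithfullyFlat.of_finite_projective_faithfulSMul R A
    rw [Subalgebra.mem_center_iff] at hz
    obtain ⟨r, hr⟩ := Module.FaithfullyFlat.exists_eq_smul_of_commute (LinearMap.mulLeft R z)
      fun S x => by
        -- Every endomorphism is a sum of maps x ↦ a x b, and these commute with multiplication by a
        -- central z.
        obtain ⟨t, rfl⟩ := (IsAzumaya.bij (R := R) (A := A)).2 S
        induction t with
        | zero => simp
        | add s t hs ht => simp only [map_add, LinearMap.add_apply, hs, ht]
        | tmul a b => simp [← mul_assoc, hz a]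
    refine Algebra.mem_bot.mpr ⟨r, ?_⟩
    simpa [Algebra.algebraMap_eq_smul_one] using (hr 1).symm

/-- Tensoring with a flat module preserves equalizers. -/
theorem Module.Flat.exists_lTensor_subtype_eq {R M P Q : Type*} [CommRing R] [AddCommGroup M]
    [Module R M] [Module.Flat R M] [AddCommGroup P] [Module R P] [AddCommMonoid Q] [Module R Q]
    {f g : P →ₗ[R] Q} {H : Submodule R P} (hH : ∀ p, p ∈ H ↔ f p = g p) {z : M ⊗[R] P}
    (hz : f.lTensor M z = g.lTensor M z) : ∃ w, H.subtype.lTensor M w = z := by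
  -- Negatives in Q come from the scalar -1, so the equalizer can be treated as the kernel of f - g.
  let _ : AddCommGroup Q := Module.addCommMonoidToAddCommGroup R
  have hexact : Function.Exact (H.subtype.lTensor M) ((f - g).lTensor M) := by
    refine Module.Flat.lTensor_exact M fun p => ?_
    rw [LinearMap.sub_apply, sub_eq_zero, ← hH]
    simp
  exact (hexact z).mp (by rw [LinearMap.lTensor_sub, LinearMap.sub_apply, hz, sub_self])

/-- Biduality is natural, so for reflexive modules f is recovered from its double transpose. -/
theorem Module.IsReflexive.dualMap_bijective_iff {R M N : Type*} [CommRing R] [AddCommGroup M]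
    [Module R M] [AddCommGroup N] [Module R N] [Module.IsReflexive R M] [Module.IsReflexive R N]
    (f : M →ₗ[R] N) : Function.Bijective f.dualMap ↔ Function.Bijective f := by
  refine ⟨fun h => ?_, fun h => (LinearEquiv.ofBijective f h).dualMap.bijective⟩
  have h2 : Function.Bijective f.dualMap.dualMap :=
    (LinearEquiv.ofBijective f.dualMap h).dualMap.bijective
  have hc : ⇑(Module.Dual.eval R N) ∘ f = f.dualMap.dualMap ∘ Module.Dual.eval R M := rfl
  rw [← Function.Bijective.of_comp_iff' (Module.bijective_dual_eval R N), hc]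
  exact h2.comp (Module.bijective_dual_eval R M)

/-- Uncurrying turns M* ⊗ N* → Hom(M, N*) into this map, so finiteness and projectivity are needed
for M only. -/
theorem TensorProduct.dualDistrib_bijective (R M N : Type*) [CommRing R] [AddCommGroup M]
    [Module R M] [AddCommGroup N] [Module R N] [Module.Finite R M] [Module.Projective R M] :
    Function.Bijective (TensorProduct.dualDistrib R M N) := by
  have h : TensorProduct.dualDistrib R M N =
      (TensorProduct.lift.equiv (.id R) M N R).toLinearMap ∘ₗ
        dualTensorHom R M (Module.Dual R N) := by
    ext f g m n
    simp
  rw [h, LinearMap.coe_comp]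
  exact (LinearEquiv.bijective (TensorProduct.lift.equiv (.id R) M N R)).comp
    dualTensorHom_bijective

namespace AzumayaCoalg
open Coalgebra CategoryTheory

/-! ### Duality between the Azumaya map of C* and the Galois map of C. -/

section
variable (R C : Type u) [CommRing R] [AddCommGroup C] [Module R C]

instance [Module.Finite R C] : Module.Finite R (CoOp C) := .equiv (CoOp.equiv R C)
instance [Module.Projective R C] : Module.Projective R (CoOp C) := .of_equiv (CoOp.equiv R C)

/-- The identity of `C*`, as a linear equivalence from the dual algebra to the dual module. -/
def dualAlgEquiv : DualAlg R C ≃ₗ[R] Module.Dual R C :=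
  (MulOpposite.opLinearEquiv R).symm ≪≫ₗ WithConv.linearEquiv R (C →ₗ[R] R)

/-- The pairing of `C* ⊗ (C*)ᵒᵖ` with `Cᵉ`. -/
def dualEnvPairing : DualAlg R C ⊗[R] (DualAlg R C)ᵐᵒᵖ →ₗ[R] Module.Dual R (Env R C) :=
  TensorProduct.dualDistrib R C (CoOp C) ∘ₗ
    (TensorProduct.congr
      ((MulOpposite.opLinearEquiv R).symm ≪≫ₗ dualAlgEquiv R C)
      (dualAlgEquiv R C ≪≫ₗ (CoOp.equiv R C).symm.dualMap)).toLinearMap ∘ₗ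
    (TensorProduct.comm R (DualAlg R C) (DualAlg R C)ᵐᵒᵖ).toLinearMap

theorem dualEnvPairing_bijective [Module.Finite R C] [Module.Projective R C] :
    Function.Bijective (dualEnvPairing R C) := by
  rw [dualEnvPairing, LinearMap.coe_comp, LinearMap.coe_comp]
  exact (TensorProduct.dualDistrib_bijective R C (CoOp C)).comp
    ((TensorProduct.congr _ _).bijective.comp (TensorProduct.comm R _ _).bijective)

/-- The pairing of `End_R(C*)` with `C ⊗ C*`. -/
def dualEndPairing : Module.End R (DualAlg R C) ≃ₗ[R] Module.Dual R (C ⊗[R] (C →ₗ[R] R)) :=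
  LinearEquiv.arrowCongr (dualAlgEquiv R C) (dualAlgEquiv R C) ≪≫ₗ
    TensorProduct.lift.equiv (.id R) (C →ₗ[R] R) C R ≪≫ₗ
      (TensorProduct.comm R C (C →ₗ[R] R)).dualMap

variable {R C} [Coalgebra R C]

theorem dualAlgEquiv_mul (f g : DualAlg R C) :
    dualAlgEquiv R C (f * g) = LinearMap.mul' R R ∘ₗ
      TensorProduct.map (dualAlgEquiv R C g) (dualAlgEquiv R C f) ∘ₗ comul := rfl

theorem dualAlgEquiv_one : dualAlgEquiv R C 1 = counit := by
  ext c
  simp [dualAlgEquiv]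

variable (R C)

/-- Scalars that agree on C agree on functionals. Conversely, rε = sε implies rc = sc because c =
ε(c₁)c₂; no projectivity is involved. -/
theorem faithfulSMul_dualAlg_iff : FaithfulSMul R (DualAlg R C) ↔ FaithfulSMul R C := by
  refine ⟨fun h => ⟨fun {r s} hrs => ?_⟩, fun h => ⟨fun {r s} hrs => ?_⟩⟩
  · refine h.eq_of_smul_eq_smul fun f => (dualAlgEquiv R C).injective ?_
    ext c
    rw [map_smul, map_smul, LinearMap.smul_apply, LinearMap.smul_apply, ← map_smul, hrs, map_smul]
  · refine h.eq_of_smul_eq_smul fun c => ?_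
    have h1 := congrArg (dualAlgEquiv R C) (hrs 1)
    rw [map_smul, map_smul, dualAlgEquiv_one] at h1
    have h2 := congrArg (fun f : C →ₗ[R] R => TensorProduct.lid R C (f.rTensor C (comul c))) h1
    simpa [LinearMap.rTensor_smul] using h2

/-- Both sides send a ⊗ b and c ⊗ h to b(c₁) h(c₂) a(c₃). The reversed product of C* makes b meet
c₁, which accounts for the swap in `dualEnvPairing`. -/
theorem dualEndPairing_comp_mulLeftRight :
    (dualEndPairing R C).toLinearMap ∘ₗ (AlgHom.mulLeftRight R (DualAlg R C)).toLinearMap =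
      (preGaloisMap R C R).dualMap ∘ₗ (TensorProduct.rid R (Env R C)).toLinearMap.dualMap ∘ₗ
        dualEnvPairing R C := by
  refine TensorProduct.ext' fun a b => TensorProduct.ext' fun c h => ?_
  obtain ⟨h, rfl⟩ := (dualAlgEquiv R C).surjective h
  change dualAlgEquiv R C (AlgHom.mulLeftRight R (DualAlg R C) (a ⊗ₜ b)
    ((dualAlgEquiv R C).symm (dualAlgEquiv R C h))) c =
      dualEnvPairing R C (a ⊗ₜ b) (TensorProduct.rid R (Env R C)
        (preGaloisMap R C R (c ⊗ₜ dualAlgEquiv R C h)))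
  rw [LinearEquiv.symm_apply_apply, AlgHom.mulLeftRight_apply, preGaloisMap_tmul, bicoact,
    dualAlgEquiv_mul, dualAlgEquiv_mul]
  simp only [LinearMap.comp_apply]
  hopf_tensor_induction comul (R := R) c with x y
  simp only [TensorProduct.map_tmul, LinearMap.lTensor_tmul, LinearMap.comp_apply]
  hopf_tensor_induction comul (R := R) y with z w
  simp [dualEnvPairing]
  ring

/-- The previous identity makes the Azumaya map the transpose of γ_R up to isomorphisms, and between
reflexive modules a transpose detects bijectivity. -/
theorem mulLeftRight_bijective_iff [Module.Finite R C] [Module.Projective R C] :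
    Function.Bijective (AlgHom.mulLeftRight R (DualAlg R C)) ↔
      Function.Bijective (preGaloisMap R C R) := by
  have h : ⇑(dualEndPairing R C) ∘ AlgHom.mulLeftRight R (DualAlg R C) =
      (preGaloisMap R C R).dualMap ∘ ⇑((TensorProduct.rid R (Env R C)).dualMap) ∘
        dualEnvPairing R C :=
    congrArg DFunLike.coe (dualEndPairing_comp_mulLeftRight R C)
  have hb : Function.Bijective (⇑((TensorProduct.rid R (Env R C)).dualMap) ∘
      dualEnvPairing R C) :=
    (LinearEquiv.bijective _).comp (dualEnvPairing_bijective R C)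
  rw [← Module.IsReflexive.dualMap_bijective_iff, ← Function.Bijective.of_comp_iff _ hb, ← h,
    Function.Bijective.of_comp_iff' (dualEndPairing R C).bijective]
end

/-! ### The Galois map: dependence on N, finiteness of C, cofree comodules. -/

section
variable (R C : Type u) [CommRing R] [AddCommGroup C] [Module R C] [Coalgebra R C]

/-- Reduces γ_N to γ_R ⊗ N, up to the canonical map C* ⊗ N → Hom(C, N). -/
theorem preGaloisMap_comp_dualTensorHom (N : Type u) [AddCommGroup N] [Module R N] :
    preGaloisMap R C N ∘ₗ (dualTensorHom R C N).lTensor C ∘ₗ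
        (TensorProduct.assoc R C (C →ₗ[R] R) N).toLinearMap =
      (TensorProduct.lid R N).toLinearMap.lTensor (Env R C) ∘ₗ
        (TensorProduct.assoc R (Env R C) R N).toLinearMap ∘ₗ
          (preGaloisMap R C R).rTensor N := by
  refine TensorProduct.ext_threefold fun c f n => ?_
  simp only [LinearMap.comp_apply, LinearEquiv.coe_coe, TensorProduct.assoc_tmul,
    LinearMap.lTensor_tmul, LinearMap.rTensor_tmul, preGaloisMap_tmul]
  hopf_tensor_induction bicoact R C c with x y
  simp

variable {R C}

theorem preGaloisMap_bijective_comp_dualTensorHom (h : Function.Bijective (preGaloisMap R C R))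
    (N : Type u) [AddCommGroup N] [Module R N] :
    Function.Bijective (preGaloisMap R C N ∘ (dualTensorHom R C N).lTensor C) := by
  have hb : Function.Bijective ((preGaloisMap R C R).rTensor N) :=
    (TensorProduct.congr (LinearEquiv.ofBijective _ h) (LinearEquiv.refl R N)).bijective
  have hl : Function.Bijective ((TensorProduct.lid R N).toLinearMap.lTensor (Env R C)) :=
    (LinearEquiv.lTensor (Env R C) (TensorProduct.lid R N)).bijective
  rw [← Function.Bijective.of_comp_iff _ (TensorProduct.assoc R C (C →ₗ[R] R) N).bijective]
  have hc := congrArg DFunLike.coe (preGaloisMap_comp_dualTensorHom R C N)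
  refine Eq.mpr (congrArg Function.Bijective hc) ?_
  exact hl.comp ((TensorProduct.assoc R (Env R C) R N).bijective.comp hb)

theorem preGaloisMap_bijective [Module.Finite R C] [Module.Projective R C]
    (h : Function.Bijective (preGaloisMap R C R)) (N : Type u) [AddCommGroup N] [Module R N] :
    Function.Bijective (preGaloisMap R C N) := by
  have hb : Function.Bijective ((dualTensorHom R C N).lTensor C) :=
    (LinearEquiv.lTensor C (dualTensorHomEquiv R C N)).bijective
  rw [← Function.Bijective.of_comp_iff _ hb]
  exact preGaloisMap_bijective_comp_dualTensorHom h N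

/-- Both γ_C and its composite with C ⊗ (C* ⊗ C → End C) are bijective, hence so is the second
factor. Reflection of isomorphisms removes the outer C, and the identity of C then comes from a
finite dual basis. -/
theorem finite_and_projective_of_preGaloisMap_bijective
    [(tensorFunctor R C).ReflectsIsomorphisms]
    (h : ∀ (N : Type u) [AddCommGroup N] [Module R N], Function.Bijective (preGaloisMap R C N)) :
    Module.Finite R C ∧ Module.Projective R C := by
  have hb : Function.Bijective ((dualTensorHom R C C).lTensor C) := by
    rw [← Function.Bijective.of_comp_iff' (h C)]
    exact preGaloisMap_bijective_comp_dualTensorHom (h R) C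
  let φ : ModuleCat.of R ((C →ₗ[R] R) ⊗[R] C) ⟶ ModuleCat.of R (C →ₗ[R] C) :=
    ModuleCat.ofHom (dualTensorHom R C C)
  have : IsIso ((tensorFunctor R C).map φ) := (ConcreteCategory.isIso_iff_bijective _).mpr hb
  have : IsIso φ := isIso_of_reflects_iso φ (tensorFunctor R C)
  have hs : Function.Bijective (dualTensorHom R C C) :=
    (ConcreteCategory.isIso_iff_bijective φ).mp this
  exact ⟨.of_one_mem_range_dualTensorHom (hs.2 1), .of_one_mem_range_dualTensorHom (hs.2 1)⟩

/-- `C` is f.g. projective and `C*` is Azumaya as soon as `C ⊗ Hom(C, -) → Cᵉ ⊗ -` is an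
isomorphism, `C ⊗ -` reflects isomorphisms and `C` is faithful. -/
theorem isAzumaya_of_preGaloisMap_bijective
    [(tensorFunctor R C).ReflectsIsomorphisms] (hf : FaithfulSMul R (DualAlg R C))
    (h : ∀ (N : Type u) [AddCommGroup N] [Module R N], Function.Bijective (preGaloisMap R C N)) :
    (Module.Finite R C ∧ Module.Projective R C) ∧ IsAzumaya R (DualAlg R C) := by
  have hC := finite_and_projective_of_preGaloisMap_bijective h
  have := hC.1
  have := hC.2
  have := Module.Projective.of_equiv (dualAlgEquiv R C).symm
  have := Module.Finite.equiv (dualAlgEquiv R C).symm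
  exact ⟨hC, { bij := (mulLeftRight_bijective_iff R C).mpr (h R) }⟩

/-- The map `Hom_R(C, N) → ^{Cᵉ}Hom(C, Cᵉ ⊗ N)`, `g ↦ (Cᵉ ⊗ g) ∘ ρ_C`. -/
def toComoduleHomCofree (N : ModuleCat.{u} R) :
    (C →ₗ[R] N) →ₗ[R] comoduleHom R C ((tensorComonad R (Env R C)).cofree.obj N) where
  toFun g := ⟨g.lTensor (Env R C) ∘ₗ bicoact R C, fun c => by
      have h := congrArg ((g.lTensor (Env R C)).lTensor (Env R C)) (bicoact_coassoc R C c)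
      change TensorProduct.assoc R (Env R C) (Env R C) N ((comul : Env R C →ₗ[R] _).rTensor N
        (g.lTensor (Env R C) (bicoact R C c))) =
          (g.lTensor (Env R C) ∘ₗ bicoact R C).lTensor (Env R C) (bicoact R C c)
      rw [LinearMap.lTensor_comp]
      refine Eq.trans ?_ h
      hopf_tensor_induction bicoact R C c with x y
      simp only [LinearMap.rTensor_tmul, LinearMap.lTensor_tmul]
      hopf_tensor_induction comul (R := R) x with z w
      rfl⟩
  map_add' f g := by
    refine Subtype.ext (LinearMap.ext fun c => ?_)
    exact LinearMap.congr_fun (LinearMap.lTensor_add (Env R C) f g) (bicoact R C c)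
  map_smul' r f := by
    refine Subtype.ext (LinearMap.ext fun c => ?_)
    exact LinearMap.congr_fun (LinearMap.lTensor_smul (Env R C) r f) (bicoact R C c)

/-- The universal property of the cofree comodule Cᵉ ⊗ N: the inverse composes with ε ⊗ N. -/
theorem toComoduleHomCofree_bijective (N : ModuleCat.{u} R) :
    Function.Bijective (toComoduleHomCofree (C := C) N) := by
  have hε (f : C →ₗ[R] N) (z : Env R C ⊗[R] C) :
      TensorProduct.lid R N ((counit : Env R C →ₗ[R] R).rTensor N (f.lTensor (Env R C) z)) =
        f (TensorProduct.lid R C ((counit : Env R C →ₗ[R] R).rTensor C z)) := by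
    hopf_tensor_induction z with x y
    simp
  constructor
  · intro f g hfg
    ext c
    have h := congrArg (fun z : Env R C ⊗[R] N =>
      TensorProduct.lid R N ((counit : Env R C →ₗ[R] R).rTensor N z))
        (LinearMap.congr_fun (congrArg Subtype.val hfg) c)
    change TensorProduct.lid R N ((counit : Env R C →ₗ[R] R).rTensor N
      (f.lTensor (Env R C) (bicoact R C c))) = TensorProduct.lid R N
        ((counit : Env R C →ₗ[R] R).rTensor N (g.lTensor (Env R C) (bicoact R C c))) at h
    rwa [hε, hε, bicoact_counit] at h
  · intro f
    let e : Env R C ⊗[R] N →ₗ[R] N :=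
      (TensorProduct.lid R N).toLinearMap ∘ₗ (counit : Env R C →ₗ[R] R).rTensor N
    let f' : C →ₗ[R] Env R C ⊗[R] N := f.1
    refine ⟨e ∘ₗ f', Subtype.ext (LinearMap.ext fun c => ?_)⟩
    have h : TensorProduct.assoc R (Env R C) (Env R C) N
      ((comul : Env R C →ₗ[R] _).rTensor N (f' c)) =
        f'.lTensor (Env R C) (bicoact R C c) := f.2 c
    -- By the counit law Cᵉ ⊗ e undoes the comultiplication; applied to the colinearity of f' it
    -- returns f'.
    have hr : e.lTensor (Env R C) (TensorProduct.assoc R (Env R C) (Env R C) N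
        ((comul : Env R C →ₗ[R] _).rTensor N (f' c))) = f' c :=
      LinearMap.congr_fun (ModuleCat.hom_ext_iff.mp
        ((tensorComonad R (Env R C)).right_counit N)) (f' c)
    change (e ∘ₗ f').lTensor (Env R C) (bicoact R C c) = f' c
    rw [LinearMap.lTensor_comp, LinearMap.comp_apply, ← h, hr]

/-- Under Hom(C, N) ≅ ^{Cᵉ}Hom(C, Cᵉ ⊗ N), γ_N is the counit of the adjunction at Cᵉ ⊗ N. -/
theorem preGaloisMap_bijective_of_counit_bijective
    (h : ∀ X : LeftComodule R (Env R C), Function.Bijective (comparisonCounit R C X))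
    (N : Type u) [AddCommGroup N] [Module R N] : Function.Bijective (preGaloisMap R C N) := by
  let M := ModuleCat.of R N
  have hb : Function.Bijective ((toComoduleHomCofree (C := C) M).lTensor C) :=
    (LinearEquiv.lTensor C (LinearEquiv.ofBijective _ (toComoduleHomCofree_bijective M))).bijective
  have hc : preGaloisMap R C N =
      comparisonCounit R C ((tensorComonad R (Env R C)).cofree.obj M) ∘ₗ
        (toComoduleHomCofree (C := C) M).lTensor C :=
    TensorProduct.ext' fun c f => preGaloisMap_tmul R C N c f
  rw [hc]
  exact (h ((tensorComonad R (Env R C)).cofree.obj M)).comp hb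

/-- C ⊗ - is K followed by the forgetful functor of comodules, which reflects isomorphisms. -/
theorem reflectsIsomorphisms_of_isEquivalence_comparison [(comparison R C).IsEquivalence] :
    (tensorFunctor R C).ReflectsIsomorphisms :=
  inferInstanceAs (comparison R C ⋙ (tensorComonad R (Env R C)).forget).ReflectsIsomorphisms

/-- The unit at R sends r to c ↦ c ⊗ r = rc ⊗ 1, which depends only on the action of r on C. -/
theorem faithfulSMul_of_unit_injective
    (h : Function.Injective (comparisonUnit R C (ModuleCat.of R R))) : FaithfulSMul R C where
  eq_of_smul_eq_smul {r s} hrs := by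
    refine h (Subtype.ext (LinearMap.ext fun c => ?_))
    change c ⊗ₜ[R] r = c ⊗ₜ[R] s
    rw [← mul_one r, ← mul_one s, ← smul_eq_mul, ← smul_eq_mul, ← TensorProduct.smul_tmul, hrs,
      TensorProduct.smul_tmul]
end

/-! ### Bijectivity of the counit and the unit. -/

section
variable {R C : Type u} [CommRing R] [AddCommGroup C] [Module R C] [Coalgebra R C]

/-- If `C` is flat and `C ⊗ Hom(C, -) → Cᵉ ⊗ -` is an isomorphism, then evaluation
`C ⊗ H → V` is bijective for a `Cᵉ`-comodule `V` with its module `H` of comodule maps `C → V`. -/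
theorem evaluation_bijective [Module.Flat R C]
    (h : ∀ (N : Type u) [AddCommGroup N] [Module R N], Function.Bijective (preGaloisMap R C N))
    {V : Type u} [AddCommGroup V] [Module R V] (a : V →ₗ[R] Env R C ⊗[R] V)
    (hcounit : ∀ x, TensorProduct.lid R V ((counit : Env R C →ₗ[R] R).rTensor V (a x)) = x)
    (hcoassoc : ∀ x, TensorProduct.assoc R (Env R C) (Env R C) V
      ((comul : Env R C →ₗ[R] _).rTensor V (a x)) = a.lTensor (Env R C) (a x))
    (H : Submodule R (C →ₗ[R] V))
    (hH : ∀ f, f ∈ H ↔ ∀ c, a (f c) = f.lTensor (Env R C) (bicoact R C c)) :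
    Function.Bijective (TensorProduct.lift (LinearMap.flip H.subtype)) := by
  let δ : Env R C ⊗[R] V →ₗ[R] Env R C ⊗[R] (Env R C ⊗[R] V) :=
    (TensorProduct.assoc R (Env R C) (Env R C) V).toLinearMap ∘ₗ (comul : Env R C →ₗ[R] _).rTensor V
  have hinj : Function.Injective a := Function.LeftInverse.injective
    (g := fun z => TensorProduct.lid R V ((counit : Env R C →ₗ[R] R).rTensor V z)) hcounit
  -- H is the equalizer of d₁ and d₂. The maps γ carry C ⊗ d₁ and C ⊗ d₂ to Cᵉ ⊗ a and δ, whose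
  -- equalizer contains the image of a.
  let d₂ : (C →ₗ[R] V) →ₗ[R] (C →ₗ[R] Env R C ⊗[R] V) :=
    LinearMap.lcomp R (Env R C ⊗[R] V) (bicoact R C) ∘ₗ LinearMap.lTensorHom (Env R C)
  let d₁ : (C →ₗ[R] V) →ₗ[R] (C →ₗ[R] Env R C ⊗[R] V) := a.compRight R (M := C)
  let ι : H →ₗ[R] (C →ₗ[R] V) := H.subtype
  have hι : Function.Injective (ι.lTensor C) :=
    Module.Flat.lTensor_preserves_injective_linearMap ι Subtype.val_injective
  have hev (z : C ⊗[R] H) : preGaloisMap R C V (ι.lTensor C z) =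
      a (TensorProduct.lift (LinearMap.flip H.subtype) z) := by
    refine LinearMap.congr_fun (f := preGaloisMap R C V ∘ₗ ι.lTensor C)
      (g := a ∘ₗ TensorProduct.lift (LinearMap.flip H.subtype))
      (TensorProduct.ext' fun c f => ?_) z
    exact (preGaloisMap_tmul R C V c f.1).trans ((hH _).mp f.2 c).symm
  have hd₁ (z : C ⊗[R] (C →ₗ[R] V)) : preGaloisMap R C (Env R C ⊗[R] V) (d₁.lTensor C z) =
      a.lTensor (Env R C) (preGaloisMap R C V z) := by
    refine LinearMap.congr_fun (f := preGaloisMap R C (Env R C ⊗[R] V) ∘ₗ d₁.lTensor C)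
      (g := a.lTensor (Env R C) ∘ₗ preGaloisMap R C V) (TensorProduct.ext' fun c f => ?_) z
    change preGaloisMap R C (Env R C ⊗[R] V) (c ⊗ₜ (a ∘ₗ f)) =
      a.lTensor (Env R C) (preGaloisMap R C V (c ⊗ₜ f))
    rw [preGaloisMap_tmul, preGaloisMap_tmul, LinearMap.lTensor_comp, LinearMap.comp_apply]
  have hd₂ (z : C ⊗[R] (C →ₗ[R] V)) : preGaloisMap R C (Env R C ⊗[R] V) (d₂.lTensor C z) =
      δ (preGaloisMap R C V z) := by
    refine LinearMap.congr_fun (f := preGaloisMap R C (Env R C ⊗[R] V) ∘ₗ d₂.lTensor C)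
      (g := δ ∘ₗ preGaloisMap R C V) (TensorProduct.ext' fun c f => ?_) z
    change preGaloisMap R C (Env R C ⊗[R] V) (c ⊗ₜ (f.lTensor (Env R C) ∘ₗ bicoact R C)) =
      δ (preGaloisMap R C V (c ⊗ₜ f))
    rw [preGaloisMap_tmul, preGaloisMap_tmul, LinearMap.lTensor_comp, LinearMap.comp_apply,
      ← bicoact_coassoc]
    hopf_tensor_induction bicoact R C c with x y
    simp only [LinearMap.rTensor_tmul, LinearMap.lTensor_tmul, δ, LinearMap.comp_apply]
    hopf_tensor_induction comul (R := R) x with z w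
    rfl
  constructor
  · intro z w hzw
    refine hι ((h V).1 ?_)
    rw [hev, hev, hzw]
  · intro x
    obtain ⟨z, hz⟩ := (h V).2 (a x)
    -- Coassociativity at x, pulled back along γ at Cᵉ ⊗ V; flatness then lifts z to C ⊗ H.
    have hz' : d₁.lTensor C z = d₂.lTensor C z := by
      refine (h (Env R C ⊗[R] V)).1 ?_
      rw [hd₁, hd₂, hz]
      exact (hcoassoc x).symm
    have hH' (f : C →ₗ[R] V) : f ∈ H ↔ d₁ f = d₂ f :=
      ⟨fun hf => LinearMap.ext ((hH f).mp hf), fun hf => (hH f).mpr (LinearMap.congr_fun hf)⟩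
    obtain ⟨w, rfl⟩ := Module.Flat.exists_lTensor_subtype_eq hH' hz'
    exact ⟨w, hinj ((hev w).symm.trans hz)⟩

theorem comparisonCounit_bijective [Module.Flat R C]
    (h : ∀ (N : Type u) [AddCommGroup N] [Module R N], Function.Bijective (preGaloisMap R C N))
    (X : LeftComodule R (Env R C)) : Function.Bijective (comparisonCounit R C X) :=
  evaluation_bijective h X.a.hom (LinearMap.congr_fun (ModuleCat.hom_ext_iff.mp X.counit))
    (LinearMap.congr_fun (ModuleCat.hom_ext_iff.mp X.coassoc)) (comoduleHom R C X)
    fun _ => Iff.rfl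

/-- The triangle identity makes C ⊗ η a right inverse of a bijective counit, and C is faithfully
flat. -/
theorem comparisonUnit_bijective [Module.FaithfullyFlat R C]
    (h : ∀ X : LeftComodule R (Env R C), Function.Bijective (comparisonCounit R C X))
    (M : ModuleCat.{u} R) : Function.Bijective (comparisonUnit R C M) := by
  rw [← Module.FaithfullyFlat.lTensor_bijective_iff_bijective R C,
    ← Function.Bijective.of_comp_iff' (h ((comparison R C).obj M))]
  have hc : comparisonCounit R C ((comparison R C).obj M) ∘ₗ (comparisonUnit R C M).lTensor C =
      LinearMap.id := TensorProduct.ext' fun c m => rfl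
  exact (congrArg Function.Bijective (congrArg DFunLike.coe hc)).mpr Function.bijective_id

/-! ### Comodule endomorphisms of C and the center of C*. -/

/-- Contracting the coaction of `C` on the left and in the middle. -/
theorem lTensor_bicoact_counit_right (s : C →ₗ[R] C) (c : C) :
    TensorProduct.rid R C (TensorProduct.map ((TensorProduct.rid R C).toLinearMap ∘ₗ
      (counit : CoOp C →ₗ[R] R).lTensor C) (counit : C →ₗ[R] R)
        (s.lTensor (Env R C) (bicoact R C c))) =
      TensorProduct.rid R C (((counit : C →ₗ[R] R) ∘ₗ s).lTensor C (comul c)) := by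
  -- G(y) = y₁ε(y₂) = y; inserting it on the right-hand side splits y there as the coaction does on
  -- the left.
  let G : C →ₗ[R] C := (TensorProduct.rid R C).toLinearMap ∘ₗ
    (counit : C →ₗ[R] R).lTensor C ∘ₗ comul
  have hG : G = LinearMap.id := LinearMap.ext fun y => by simp [G]
  have h : (counit : C →ₗ[R] R) ∘ₗ s = (counit : C →ₗ[R] R) ∘ₗ s ∘ₗ G := by
    rw [hG, LinearMap.comp_id]
  rw [h, bicoact]
  simp only [LinearMap.comp_apply]
  hopf_tensor_induction comul (R := R) c with x y
  simp only [LinearMap.lTensor_tmul, LinearMap.comp_apply, G]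
  hopf_tensor_induction comul (R := R) y with z w
  simp only [LinearEquiv.coe_coe, TensorProduct.comm_tmul, LinearMap.rTensor_tmul,
    TensorProduct.assoc_symm_tmul, LinearMap.lTensor_tmul, TensorProduct.map_tmul,
    LinearMap.comp_apply, TensorProduct.rid_tmul, CoOp.counit_apply, map_smul, smul_eq_mul,
    mul_smul]
  rw [smul_comm]

/-- With its companion this writes a comodule endomorphism s both as c₁ε(s c₂) and as ε(s c₁)c₂,
which makes ε ∘ s central in C*. -/
theorem lTensor_bicoact_counit_left (s : C →ₗ[R] C) (c : C) :
    TensorProduct.rid R C (TensorProduct.map ((TensorProduct.lid R C).toLinearMap ∘ₗ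
      TensorProduct.map (counit : C →ₗ[R] R) (CoOp.equiv R C).symm.toLinearMap)
        (counit : C →ₗ[R] R) (s.lTensor (Env R C) (bicoact R C c))) =
      TensorProduct.lid R C (((counit : C →ₗ[R] R) ∘ₗ s).rTensor C (comul c)) := by
  let G : C →ₗ[R] C := (TensorProduct.lid R C).toLinearMap ∘ₗ
    ((counit : C →ₗ[R] R) ∘ₗ s).rTensor C ∘ₗ comul
  have hG : G (TensorProduct.lid R C ((counit : C →ₗ[R] R).rTensor C (comul c))) = G c := by
    simp
  refine Eq.trans ?_ hG
  rw [bicoact]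
  simp only [LinearMap.comp_apply]
  hopf_tensor_induction comul (R := R) c with x y
  simp only [LinearMap.lTensor_tmul, LinearMap.rTensor_tmul, LinearMap.comp_apply,
    TensorProduct.lid_tmul, map_smul, G]
  induction comul (R := R) y with
  | zero => simp
  | add p q hp hq => simp only [map_add, TensorProduct.tmul_add, smul_add, hp, hq]
  | tmul z w =>
    simpa using smul_comm _ _ _

/-- If the dual algebra is central, the comodule endomorphisms of `C` are the scalars. -/
theorem exists_eq_smul_of_mem_comoduleEnd [Algebra.IsCentral R (DualAlg R C)] {s : C →ₗ[R] C}
    (hs : s ∈ comoduleEnd R C) : ∃ r : R, s = r • LinearMap.id := by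
  have hs' (c : C) : bicoact R C (s c) = s.lTensor (Env R C) (bicoact R C c) := hs c
  have h1 (c : C) : s c =
      TensorProduct.rid R C (((counit : C →ₗ[R] R) ∘ₗ s).lTensor C (comul c)) := by
    have h := lTensor_bicoact_counit_right (R := R) LinearMap.id (s c)
    rw [LinearMap.lTensor_id, LinearMap.id_apply, hs', lTensor_bicoact_counit_right] at h
    simpa using h.symm
  have h2 (c : C) : s c =
      TensorProduct.lid R C (((counit : C →ₗ[R] R) ∘ₗ s).rTensor C (comul c)) := by
    have h := lTensor_bicoact_counit_left (R := R) LinearMap.id (s c)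
    rw [LinearMap.lTensor_id, LinearMap.id_apply, hs', lTensor_bicoact_counit_left] at h
    simpa using h.symm
  let z : DualAlg R C := (dualAlgEquiv R C).symm ((counit : C →ₗ[R] R) ∘ₗ s)
  have hz : z ∈ Subalgebra.center R (DualAlg R C) := by
    refine Subalgebra.mem_center_iff.mpr fun f => (dualAlgEquiv R C).injective ?_
    ext c
    rw [dualAlgEquiv_mul, dualAlgEquiv_mul]
    simp only [LinearEquiv.apply_symm_apply, LinearMap.comp_apply, z]
    -- Applying f to the two expressions for s(c) gives the two products of f with z.
    have h := congrArg (dualAlgEquiv R C f) ((h2 c).symm.trans (h1 c))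
    refine Eq.trans ?_ (h.trans ?_)
    · hopf_tensor_induction comul (R := R) c with x y
      simp
    · hopf_tensor_induction comul (R := R) c with x y
      simp [mul_comm]
  obtain ⟨r, hr⟩ := Algebra.mem_bot.mp (Algebra.IsCentral.out hz)
  have hr' : (counit : C →ₗ[R] R) ∘ₗ s = r • counit := by
    refine ((dualAlgEquiv R C).apply_symm_apply _).symm.trans ?_
    change dualAlgEquiv R C z = _
    rw [← hr, Algebra.algebraMap_eq_smul_one, map_smul, dualAlgEquiv_one]
  refine ⟨r, LinearMap.ext fun c => ?_⟩
  rw [h1, hr', LinearMap.lTensor_smul]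
  simp

/-- Elements of S are scalars, so the relations that define ⊗_S already hold over R. -/
theorem preGaloisMap_bijective_of_isGalois [Algebra.IsCentral R (DualAlg R C)]
    (h : IsGalois R C) (N : Type u) [AddCommGroup N] [Module R N] :
    Function.Bijective (preGaloisMap R C N) := by
  have hb : balanced R C N = ⊥ := by
    refine (Submodule.span_eq_bot).mpr ?_
    rintro _ ⟨s, hs, c, f, rfl⟩
    obtain ⟨r, rfl⟩ := exists_eq_smul_of_mem_comoduleEnd hs
    simp [LinearMap.comp_smul, TensorProduct.smul_tmul]
  have hc : ⇑(preGaloisMap R C N) = galoisMap R C N ∘ (balanced R C N).mkQ := rfl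
  rw [hc]
  refine (h N).comp ⟨?_, Submodule.mkQ_surjective _⟩
  rw [← LinearMap.ker_eq_bot, Submodule.ker_mkQ, hb]

theorem isGalois_of_preGaloisMap_bijective
    (h : ∀ (N : Type u) [AddCommGroup N] [Module R N], Function.Bijective (preGaloisMap R C N)) :
    IsGalois R C := by
  intro N _ _
  constructor
  · intro x y hxy
    obtain ⟨x, rfl⟩ := Submodule.mkQ_surjective _ x
    obtain ⟨y, rfl⟩ := Submodule.mkQ_surjective _ y
    exact congrArg _ ((h N).1 hxy)
  · intro z
    obtain ⟨x, rfl⟩ := (h N).2 z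
    exact ⟨(balanced R C N).mkQ x, rfl⟩
end

/-! ### Comonadicity and reflection of isomorphisms. -/

section
variable (R D : Type u) [CommRing R] [AddCommGroup D] [Module R D]

/-- The functor `D ⊗_R -` is tensoring on the left in the monoidal category of `R`-modules. -/
def tensorFunctorIso : tensorFunctor R D ≅ MonoidalCategory.tensorLeft (ModuleCat.of R D) :=
  NatIso.ofComponents (fun _ => Iso.refl _)

theorem reflectsIsomorphisms_tensorFunctor [Module.FaithfullyFlat R D] :
    (tensorFunctor R D).ReflectsIsomorphisms where
  reflects f hf := (ConcreteCategory.isIso_iff_bijective f).mpr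
    ((Module.FaithfullyFlat.lTensor_bijective_iff_bijective R D f.hom).mp
      ((ConcreteCategory.isIso_iff_bijective _).mp hf))

/-- If `D` is faithfully flat then `D ⊗_R -` is comonadic. -/
theorem nonempty_comonadicLeftAdjoint_tensorFunctor [Module.FaithfullyFlat R D] :
    Nonempty (ComonadicLeftAdjoint (tensorFunctor R D)) := by
  have := reflectsIsomorphisms_tensorFunctor R D
  have : Module.Flat R (ModuleCat.of R D) := inferInstanceAs (Module.Flat R D)
  have : Limits.PreservesFiniteLimits (tensorFunctor R D) :=
    Limits.preservesFiniteLimits_of_natIso (tensorFunctorIso R D).symm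
  have : Comonad.PreservesLimitOfIsCoreflexivePair (tensorFunctor R D) :=
    ⟨fun _ _ _ => inferInstance⟩
  -- Beck's theorem: flatness preserves equalizers, faithful flatness reflects isomorphisms, and the
  -- right adjoint is the internal Hom.
  exact ⟨Comonad.comonadicOfHasPreservesCoreflexiveEqualizersOfReflectsIsomorphisms
    ((ihom.adjunction (ModuleCat.of R D)).ofNatIsoLeft (tensorFunctorIso R D).symm)⟩
end

theorem reflectsIsomorphisms_of_comonadicLeftAdjoint {A B : Type*} [Category A] [Category B]
    (F : A ⥤ B) [ComonadicLeftAdjoint F] : F.ReflectsIsomorphisms :=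
  reflectsIsomorphisms_of_iso (Comonad.comparisonForget (comonadicAdjunction F))

/-! ### The adjunction and the equivalence of the four conditions. -/

section
variable (R C : Type u) [CommRing R] [AddCommGroup C] [Module R C] [Coalgebra R C]

theorem isIso_counit_app_iff (X : LeftComodule R (Env R C)) :
    IsIso ((comparisonAdj R C).counit.app X) ↔ Function.Bijective (comparisonCounit R C X) := by
  rw [← isIso_iff_of_reflects_iso _ (tensorComonad R (Env R C)).forget]
  exact ConcreteCategory.isIso_iff_bijective (ModuleCat.ofHom (comparisonCounit R C X))

theorem isIso_unit_app_iff (M : ModuleCat.{u} R) :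
    IsIso ((comparisonAdj R C).unit.app M) ↔ Function.Bijective (comparisonUnit R C M) :=
  ConcreteCategory.isIso_iff_bijective (ModuleCat.ofHom (comparisonUnit R C M))
end

end AzumayaCoalg

end

open AzumayaCoalg CategoryTheory in
theorem mainTheorem4 (R C : Type u) [CommRing R] [AddCommGroup C] [Module R C] [Coalgebra R C] :
    List.TFAE [
      AzumayaCoalg.IsAzumayaCoalgebra R C,
      (∀ X : AzumayaCoalg.LeftComodule R (AzumayaCoalg.Env R C),
          CategoryTheory.IsIso ((AzumayaCoalg.comparisonAdj R C).counit.app X)) ∧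
        (∀ M : ModuleCat.{u} R,
          CategoryTheory.IsIso ((AzumayaCoalg.comparisonAdj R C).unit.app M)),
      AzumayaCoalg.IsGalois R C ∧ AzumayaCoalg.IsCentralDual R C ∧
        Nonempty (CategoryTheory.ComonadicLeftAdjoint (AzumayaCoalg.tensorFunctor R C)),
      (Module.Finite R C ∧ Module.Projective R C) ∧
        IsAzumaya R (AzumayaCoalg.DualAlg R C)] := by
  tfae_have 1 → 2 := fun h => by
    have : (comparison R C).IsEquivalence := h
    exact ⟨fun X => inferInstance, fun M => inferInstance⟩
  tfae_have 2 → 1 := fun ⟨h1, h2⟩ => (comparisonAdj R C).toEquivalence.isEquivalence_functor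
  tfae_have 2 → 4 := fun ⟨h1, h2⟩ => by
    have : (comparison R C).IsEquivalence := tfae_2_to_1 ⟨h1, h2⟩
    have := reflectsIsomorphisms_of_isEquivalence_comparison (R := R) (C := C)
    refine isAzumaya_of_preGaloisMap_bijective ((faithfulSMul_dualAlg_iff R C).mpr
      (faithfulSMul_of_unit_injective ((isIso_unit_app_iff R C _).mp (h2 _)).1)) ?_
    exact preGaloisMap_bijective_of_counit_bijective
      fun X => (isIso_counit_app_iff R C X).mp (h1 X)
  tfae_have 3 → 4 := fun ⟨hG, ⟨_, hf⟩, ⟨_⟩⟩ => by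
    have := reflectsIsomorphisms_of_comonadicLeftAdjoint (tensorFunctor R C)
    exact isAzumaya_of_preGaloisMap_bijective hf (preGaloisMap_bijective_of_isGalois hG)
  tfae_have 4 → 2 := fun ⟨⟨_, _⟩, hA⟩ => by
    -- Faithfulness, part of being Azumaya, passes from C* to C and upgrades projective to
    -- faithfully flat.
    have := (faithfulSMul_dualAlg_iff R C).mp hA.toFaithfulSMul
    have := Module.FaithfullyFlat.of_finite_projective_faithfulSMul R C
    have h := comparisonCounit_bijective
      (preGaloisMap_bijective ((mulLeftRight_bijective_iff R C).mp hA.bij))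
    exact ⟨fun X => (isIso_counit_app_iff R C X).mpr (h X),
      fun M => (isIso_unit_app_iff R C M).mpr (comparisonUnit_bijective h M)⟩
  tfae_have 4 → 3 := fun ⟨⟨_, _⟩, hA⟩ => by
    have := (faithfulSMul_dualAlg_iff R C).mp hA.toFaithfulSMul
    have := Module.FaithfullyFlat.of_finite_projective_faithfulSMul R C
    exact ⟨isGalois_of_preGaloisMap_bijective
      (preGaloisMap_bijective ((mulLeftRight_bijective_iff R C).mp hA.bij)),
      ⟨IsAzumaya.isCentral R _, hA.toFaithfulSMul⟩, nonempty_comonadicLeftAdjoint_tensorFunctor R C⟩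
  tfae_finish
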